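/- Theorem 4. Let $\Gamma$ be a compact connected metric graph, given by a finite connected weighted multigraph (loops and parallel edges allowed, positive edge lengths) whose vertices, among them $q$, are called the combinatorial vertices; thus they include $q$ and all points of degree other than $2$. Let $D$ be a divisor on $\Gamma$, i.e. a finite formal integer combination of points, with $D(p)\ge 0$ for all $p\neq q$. A firing towards $q$ is given by a partition of the combinatorial vertices into two sets $A$ and $B\ni q$ which both induce connected (nonempty) subgraphs, a length $\epsilon>0$, and on each edge between $A$ and $B$ a subinterval of length $\epsilon$; it moves one chip across each of these subintervals, from its end nearer to $A$ to its end nearer to $B$. It is legal for a divisor if the resulting divisor is nonnegative away from $q$, and maximal if, for the same partition and the same starting points, no greater length gives a legal firing. A greedy reduction of $D$ with respect to $q$ of time $\beta$ (an ordinal) is a family $(D_\alpha)_{\alpha\le\beta}$ of divisors such that $D_0=D$, for each $\alpha<\beta$ the divisor $D_{\alpha+1}$ arises from $D_\alpha$ by a maximal legal firing towards $q$, and for each limit ordinal $\lambda\le\beta$ the divisor $D_\lambda$ is the limit of $(D_\alpha)_{\alpha<\lambda}$, in the sense that $\sum_p D_\alpha(p)\varphi(p)\to\sum_p D_\lambda(p)\varphi(p)$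 for every continuous $\varphi:\Gamma\to\mathbb{R}$. Let $d=\deg(D)-D(q)$ be the number of chips away from $q$. Then: 1. Every greedy reduction of $D$ with respect to $q$ takes time at most $\omega^{d}$; in particular, it takes time at most $\omega^{\deg(D)}$ if $D(q)\ge 0$. 2. If a greedy reduction has time at least $\omega^{n-1}$, where $n\ge 1$ is an integer, then at stage $\omega^{n-1}$ at least $n$ chips, not counting the $D(q)$ chips initially at $q$, are at combinatorial vertices; that is, $\sum_{v} D_{\omega^{n-1}}(v)-D(q)\ge n$, where $v$ runs over the combinatorial vertices. 3. One can always pass to the limit: if $\lambda$ is a limit ordinal and $(D_\alpha)_{\alpha<\lambda}$ is a family whose initial parts $(D_\alpha)_{\alpha\le\beta}$ are greedy reductions of $D$ for all $\beta<\lambda$, then $(D_\alpha)_{\alpha<\lambda}$ converges to a divisor. Every greedy reduction can be continued to one that terminates, i.e. that ends at a divisor for which there is no legal firing towards $q$. -/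

import Mathlib

open scoped Ordinal Topology

universe u v w

/-- A (compact, connected) metric graph, given by a finite connected multigraph with a positive
length for each edge.  Loops and parallel edges are allowed; edges are oriented only in order to be
parametrised.  The elements of `V` are the combinatorial vertices: every other point of the metric
graph has degree two. -/
structure MetricGraph where
  V : Type u
  E : Type v
  [fintypeV : Fintype V]
  [fintypeE : Fintype E]
  src : E → V
  tgt : E → V
  length : E → ℝ
  length_pos : ∀ e, 0 < length e
  connected : (SimpleGraph.fromRel fun x y : V => ∃ e, src e = x ∧ tgt e = y).Connected

namespace MetricGraph

attribute [instance] MetricGraph.fintypeV MetricGraph.fintypeE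

variable (Γ : MetricGraph.{u, v})

/-- The adjacency relation on combinatorial vertices. -/
def graph : SimpleGraph Γ.V :=
  SimpleGraph.fromRel fun x y : Γ.V => ∃ e, Γ.src e = x ∧ Γ.tgt e = y

/-- The points of the metric graph: the vertices, and the points interior to the edges. -/
inductive Point : Type (max u v)
  | vertex (x : Γ.V) : Point
  | interior (e : Γ.E) (t : ℝ) (h : 0 < t ∧ t < Γ.length e) : Point

open Classical in
/-- The parametrisation of the edge `e` by `[0, length e]`; `pt e t` is the point of `e` at distance
`t` from the source of `e`. -/
noncomputable def pt (e : Γ.E) (t : ℝ) : Γ.Point :=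
  if h : 0 < t ∧ t < Γ.length e then Point.interior e t h
  else if t ≤ 0 then Point.vertex (Γ.src e) else Point.vertex (Γ.tgt e)

/-- The topology of the metric graph: the edges `[0, length e]` glued at their end points. -/
noncomputable instance instTopologicalSpacePoint : TopologicalSpace Γ.Point :=
  TopologicalSpace.coinduced
    (fun x : (Σ e : Γ.E, Set.Icc (0 : ℝ) (Γ.length e)) => Γ.pt x.1 x.2) inferInstance

/-- Divisors: finite formal integer combinations of points. -/
abbrev Divisor : Type (max u v) := Γ.Point →₀ ℤ

variable {Γ}

/-- The degree of a divisor. -/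
noncomputable def degree (D : Γ.Divisor) : ℤ := D.sum fun _ n => n

/-- The number of chips at the combinatorial vertices. -/
def vertexChips (D : Γ.Divisor) : ℤ := ∑ x : Γ.V, D (Point.vertex x)

/-- `D` is nonnegative away from the vertex `q`. -/
def NonnegAway (q : Γ.V) (D : Γ.Divisor) : Prop :=
  ∀ p : Γ.Point, p ≠ Point.vertex q → 0 ≤ D p

/-- The sum `∑ D(p) φ(p)` over the points `p` of the metric graph. -/
noncomputable def pairing (D : Γ.Divisor) (φ : Γ.Point → ℝ) : ℝ := D.sum fun p n => (n : ℝ) * φ p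

/-- Convergence of divisors along a filter, as (signed) measures on the compact space `Γ`.  For
divisors which have a common degree, are nonnegative away from `q`, and are bounded below at `q`,
this is convergence of the positions of the chips. -/
def DivisorTendsto {ι : Type*} (D : ι → Γ.Divisor) (l : Filter ι) (D' : Γ.Divisor) : Prop :=
  ∀ φ : Γ.Point → ℝ, Continuous φ →
    Filter.Tendsto (fun i => pairing (D i) φ) l (𝓝 (pairing D' φ))

open Classical in
/-- The edges with exactly one end point in `A`. -/
noncomputable def cut (A : Set Γ.V) : Finset Γ.E :=
  Finset.univ.filter fun e => ¬ (Γ.src e ∈ A ↔ Γ.tgt e ∈ A)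

open Classical in
/-- For an edge `e` of the cut of `A`: the point of `e` at distance `t` from its end point in `A`. -/
noncomputable def ptFrom (A : Set Γ.V) (e : Γ.E) (t : ℝ) : Γ.Point :=
  if Γ.src e ∈ A then Γ.pt e t else Γ.pt e (Γ.length e - t)

variable (Γ) in
/-- A basic chip-firing move towards `q`.  It is given by a partition of the vertices into two sides,
both inducing connected subgraphs, with `q` not in `side`, and on each edge of the cut a subinterval
of the common length `len`, which starts at distance `start e` from the end point of `e` in `side`.
The values of `start` outside the cut are irrelevant. -/
structure Firing (q : Γ.V) where
  side : Set Γ.V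
  q_notMem : q ∉ side
  connected_side : (Γ.graph.induce side).Connected
  connected_compl : (Γ.graph.induce sideᶜ).Connected
  start : Γ.E → ℝ
  len : ℝ
  len_pos : 0 < len
  start_nonneg : ∀ e ∈ cut side, 0 ≤ start e
  start_add_len_le : ∀ e ∈ cut side, start e + len ≤ Γ.length e

namespace Firing

variable {q : Γ.V}

/-- The divisor of the firing: on each edge of the cut, the starting point of the subinterval minus
its end point.  Firing replaces `D` by `D - f.div`, that is, it pushes one chip along each edge of
the cut by the distance `f.len`, towards the side of `q`. -/
noncomputable def div (f : Γ.Firing q) : Γ.Divisor :=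
  ∑ e ∈ cut f.side, (Finsupp.single (ptFrom f.side e (f.start e)) 1
    - Finsupp.single (ptFrom f.side e (f.start e + f.len)) 1)

/-- The firing causes no debt away from `q`. -/
def Legal (f : Γ.Firing q) (D : Γ.Divisor) : Prop := NonnegAway q (D - f.div)

/-- A legal firing of maximum length: the same chips cannot be pushed further along the same cut. -/
def MaximalLegal (f : Γ.Firing q) (D : Γ.Divisor) : Prop :=
  f.Legal D ∧ ∀ g : Γ.Firing q, g.side = f.side → (∀ e ∈ cut f.side, g.start e = f.start e) →
    g.Legal D → g.len ≤ f.len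

end Firing

/-- `D` is, up to stage `β`, a transfinite greedy reduction of `D₀` with respect to `q`: it starts at
`D₀`, each step before stage `β` is a maximal legal firing towards `q`, and at limit stages the
divisor is the limit of the preceding ones.  It takes time `β`, and `D β` is its last divisor. -/
structure IsGreedyReduction (q : Γ.V) (D₀ : Γ.Divisor) (β : Ordinal.{w})
    (D : Ordinal.{w} → Γ.Divisor) : Prop where
  zero : D 0 = D₀
  succ : ∀ α < β, ∃ f : Γ.Firing q, f.MaximalLegal (D α) ∧ D (Order.succ α) = D α - f.div
  limit : ∀ l ≤ β, Order.IsSuccLimit l → DivisorTendsto D (𝓝[<] l) (D l)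

end MetricGraph

/-! The proof rests on a potential. The Laplacian grounded at `q` is invertible, so some edgewise
linear function has outflow one at every vertex other than `q`. A firing lowers its pairing with the
divisor by `len` times the total outflow of `side`, hence by at least `len` (`len_le_pairing_div`).
A Lipschitz function changes by at most a constant times `len`, so it becomes monotone along the
reduction after a large multiple of the potential is added. Bounded monotone pairings converge, and
compactness of the space of chip positions supplies a divisor as the limit (`exists_limit`).

For the time bound, legality depends only on the starting points, so a maximal firing runs until
some chip reaches a vertex. Thus every successor stage has a chip at a vertex. Before a limit stage
the potential converges, so late firings are short and the chip about to arrive is already close to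
its vertex. If `m` chips sit at vertices cofinally often, this extra chip makes at least `m + 1` in
the limit (`lt_vertexChips_limit`). Induction gives `n + 1` chips at vertices after every block of
`ω ^ n` steps (`lt_vertexChips_add_opow`). With only `d` chips available, time `ω ^ d` is never
reached; this strict bound also forces continuations to stop. -/

namespace MetricGraph

variable {Γ : MetricGraph.{u, v}}

/-! ### Pairings -/

lemma pairing_eq_linearCombination (D : Γ.Divisor) (φ : Γ.Point → ℝ) :
    pairing D φ = Finsupp.linearCombination ℤ φ D := by
  simp [pairing, Finsupp.linearCombination_apply]

lemma pairing_sub (D D' : Γ.Divisor) (φ : Γ.Point → ℝ) :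
    pairing (D - D') φ = pairing D φ - pairing D' φ := by
  simp [pairing_eq_linearCombination]

lemma pairing_single (p : Γ.Point) (n : ℤ) (φ : Γ.Point → ℝ) :
    pairing (Finsupp.single p n) φ = n * φ p := by
  simp [pairing_eq_linearCombination]

lemma pairing_nonneg {D : Γ.Divisor} {φ : Γ.Point → ℝ} (hD : 0 ≤ D) (hφ : 0 ≤ φ) :
    0 ≤ pairing D φ :=
  Finset.sum_nonneg fun p _ => mul_nonneg (by exact_mod_cast hD p) (hφ p)

lemma pairing_mono_left {D D' : Γ.Divisor} {φ : Γ.Point → ℝ} (hD : D ≤ D') (hφ : 0 ≤ φ) :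
    pairing D φ ≤ pairing D' φ := by
  have := pairing_nonneg (sub_nonneg.2 hD) hφ
  rw [pairing_sub] at this
  linarith

lemma pairing_mono_right {D : Γ.Divisor} {φ φ' : Γ.Point → ℝ} (hD : 0 ≤ D) (hφ : φ ≤ φ') :
    pairing D φ ≤ pairing D φ' :=
  Finset.sum_le_sum fun p _ => mul_le_mul_of_nonneg_left (hφ p) (by exact_mod_cast hD p)

lemma pairing_const (D : Γ.Divisor) (c : ℝ) : pairing D (fun _ => c) = degree D * c := by
  simp [pairing, degree, Finsupp.sum, Finset.sum_mul]

lemma pairing_eq_apply {D : Γ.Divisor} {φ : Γ.Point → ℝ} {p : Γ.Point} (hp : φ p = 1)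
    (h : ∀ x ∈ D.support, x ≠ p → φ x = 0) : pairing D φ = D p := by
  rw [pairing, Finsupp.sum, Finset.sum_eq_single p]
  · simp [hp]
  · intro x hx hxp
    simp [h x hx hxp]
  · intro hp'
    simp [Finsupp.notMem_support_iff.1 hp']

lemma degree_nonneg {D : Γ.Divisor} (hD : 0 ≤ D) : 0 ≤ degree D :=
  Finset.sum_nonneg fun p _ => hD p

lemma degree_sub (D D' : Γ.Divisor) : degree (D - D') = degree D - degree D' := by
  have := pairing_sub D D' fun _ => 1
  simp only [pairing_const, mul_one] at this
  exact_mod_cast this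

lemma degree_single (p : Γ.Point) (n : ℤ) : degree (Finsupp.single p n : Γ.Divisor) = n := by
  simp [degree]

lemma apply_le_degree {D : Γ.Divisor} (hD : 0 ≤ D) (p : Γ.Point) : D p ≤ degree D := by
  by_cases hp : p ∈ D.support
  · exact Finset.single_le_sum (f := D) (fun x _ => hD x) hp
  · rw [Finsupp.notMem_support_iff.1 hp]
    exact degree_nonneg hD

lemma vertexChips_sub (D D' : Γ.Divisor) :
    vertexChips (D - D') = vertexChips D - vertexChips D' := by
  simp [vertexChips]

lemma vertexChips_single (x : Γ.V) (n : ℤ) :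
    vertexChips (Finsupp.single (Point.vertex x) n : Γ.Divisor) = n := by
  classical
  simp [vertexChips, Finsupp.single_apply]

/-- The function which is one at the combinatorial vertices and zero elsewhere. -/
def vertexIndicator : Γ.Point → ℝ
  | .vertex _ => 1
  | .interior _ _ _ => 0

lemma pairing_vertexIndicator (D : Γ.Divisor) :
    pairing D vertexIndicator = vertexChips D := by
  induction D using Finsupp.induction_linear with
  | zero => simp [pairing, vertexChips]
  | add D D' h h' =>
    rw [pairing_eq_linearCombination, map_add, ← pairing_eq_linearCombination,
      ← pairing_eq_linearCombination, h, h']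
    simp [vertexChips, Finset.sum_add_distrib]
  | single p n =>
    rw [pairing_single]
    rcases p with x | ⟨e, t, ht⟩
    · simp [vertexChips_single, vertexIndicator]
    · simp [vertexChips, vertexIndicator]

lemma vertexChips_le_degree {D : Γ.Divisor} (hD : 0 ≤ D) : vertexChips D ≤ degree D := by
  have : pairing D vertexIndicator ≤ pairing D fun _ => 1 :=
    pairing_mono_right hD fun p => by cases p <;> simp [vertexIndicator]
  rw [pairing_vertexIndicator, pairing_const, mul_one] at this
  exact_mod_cast this

/-! ### Functions on a metric graph -/

/-- The function on a metric graph with given values at the vertices and in the edges. -/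
def ofEdges (a : Γ.V → ℝ) (g : Γ.E → ℝ → ℝ) : Γ.Point → ℝ
  | .vertex x => a x
  | .interior e t _ => g e t

lemma pt_zero (e : Γ.E) : Γ.pt e 0 = .vertex (Γ.src e) := by simp [pt]

lemma pt_length (e : Γ.E) : Γ.pt e (Γ.length e) = .vertex (Γ.tgt e) := by
  simp [pt, Γ.length_pos e]

lemma pt_of_mem {e : Γ.E} {t : ℝ} (h : 0 < t ∧ t < Γ.length e) :
    Γ.pt e t = .interior e t h := by simp [pt, h]

lemma ofEdges_pt {a : Γ.V → ℝ} {g : Γ.E → ℝ → ℝ} {e : Γ.E} {t : ℝ}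
    (h0 : g e 0 = a (Γ.src e)) (h1 : g e (Γ.length e) = a (Γ.tgt e))
    (ht : t ∈ Set.Icc 0 (Γ.length e)) : ofEdges a g (Γ.pt e t) = g e t := by
  rcases ht.1.eq_or_lt with rfl | h
  · rw [pt_zero, h0]; rfl
  rcases ht.2.eq_or_lt with rfl | h'
  · rw [pt_length, h1]; rfl
  · rw [pt_of_mem ⟨h, h'⟩]; rfl

/-- A function which is Lipschitz along each edge. -/
def EdgeLipschitz (L : ℝ) (φ : Γ.Point → ℝ) : Prop :=
  ∀ e, ∀ s ∈ Set.Icc 0 (Γ.length e), ∀ t ∈ Set.Icc 0 (Γ.length e),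
    |φ (Γ.pt e s) - φ (Γ.pt e t)| ≤ L * |s - t|

lemma edgeLipschitz_ofEdges {a : Γ.V → ℝ} {g : Γ.E → ℝ → ℝ} {L : ℝ}
    (h0 : ∀ e, g e 0 = a (Γ.src e)) (h1 : ∀ e, g e (Γ.length e) = a (Γ.tgt e))
    (hL : ∀ e s t, |g e s - g e t| ≤ L * |s - t|) : EdgeLipschitz L (ofEdges a g) := by
  intro e s hs t ht
  rw [ofEdges_pt (h0 e) (h1 e) hs, ofEdges_pt (h0 e) (h1 e) ht]
  exact hL e s t

lemma continuous_iff_pt {φ : Γ.Point → ℝ} :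
    Continuous φ ↔ ∀ e, Continuous fun t : Set.Icc (0 : ℝ) (Γ.length e) => φ (Γ.pt e t) := by
  rw [continuous_coinduced_dom, continuous_sigma_iff]
  rfl

lemma EdgeLipschitz.continuous {L : ℝ} {φ : Γ.Point → ℝ} (h : EdgeLipschitz L φ) :
    Continuous φ := by
  refine continuous_iff_pt.2 fun e => ?_
  refine (LipschitzWith.of_dist_le_mul (K := L.toNNReal) fun s t => ?_).continuous
  rw [Real.dist_eq, Subtype.dist_eq, Real.dist_eq]
  exact (h e s s.2 t t.2).trans
    (mul_le_mul_of_nonneg_right (Real.le_coe_toNNReal L) (abs_nonneg _))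

lemma continuous_pt (e : Γ.E) : Continuous fun t : Set.Icc (0 : ℝ) (Γ.length e) => Γ.pt e t :=
  (continuous_coinduced_rng (f := fun x : (Σ e : Γ.E, Set.Icc (0 : ℝ) (Γ.length e)) =>
    Γ.pt x.1 x.2)).comp continuous_sigmaMk

instance : CompactSpace Γ.Point where
  isCompact_univ := by
    -- The vertices are listed separately because a graph with one vertex and no edges has a point
    -- on no edge.
    have : (Set.univ : Set Γ.Point) = Set.range Point.vertex ∪
        ⋃ e, Set.range fun t : Set.Icc (0 : ℝ) (Γ.length e) => Γ.pt e t := by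
      refine (Set.eq_univ_of_forall fun p => ?_).symm
      rcases p with x | ⟨e, t, ht⟩
      · exact Or.inl ⟨x, rfl⟩
      · exact Or.inr (Set.mem_iUnion.2 ⟨e, ⟨t, ht.1.le, ht.2.le⟩, pt_of_mem ht⟩)
    rw [this]
    exact (Set.finite_range _).isCompact.union
      (isCompact_iUnion fun e => isCompact_range (continuous_pt e))

lemma exists_abs_le_of_continuous {φ : Γ.Point → ℝ} (h : Continuous φ) :
    ∃ M, ∀ p, |φ p| ≤ M := by
  obtain ⟨M, hM⟩ := isCompact_univ.exists_bound_of_continuousOn h.continuousOn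
  exact ⟨M, fun p => hM p trivial⟩

/-- The function which takes the values `a` at the vertices and decreases to zero linearly within
distance `r` from the vertices. -/
noncomputable def vertexBump (a : Γ.V → ℝ) (r : ℝ) : Γ.Point → ℝ :=
  ofEdges a fun e t => a (Γ.src e) * max 0 (1 - t / r) +
    a (Γ.tgt e) * max 0 (1 - (Γ.length e - t) / r)

lemma abs_max_zero_sub_le (x y : ℝ) : |max 0 x - max 0 y| ≤ |x - y| := by
  simpa [max_comm] using abs_max_sub_max_le_abs x y 0

lemma edgeLipschitz_vertexBump {a : Γ.V → ℝ} {r M : ℝ} (hr : 0 < r) (hM : ∀ x, |a x| ≤ M)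
    (hl : ∀ e, r ≤ Γ.length e) : EdgeLipschitz (2 * M / r) (vertexBump a r) := by
  have h1 : ∀ e, 1 - Γ.length e / r ≤ 0 := fun e => by
    rw [sub_nonpos, one_le_div hr]; exact hl e
  refine edgeLipschitz_ofEdges (fun e => ?_) (fun e => ?_) fun e s t => ?_
  · simp [h1 e]
  · simp [h1 e]
  · have key : ∀ x y : ℝ, |max 0 (1 - x / r) - max 0 (1 - y / r)| ≤ |x - y| / r := fun x y => by
      refine (abs_max_zero_sub_le _ _).trans_eq ?_
      rw [show 1 - x / r - (1 - y / r) = (y - x) / r by ring, abs_div, abs_of_pos hr, abs_sub_comm]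
    have k1 := key s t
    have k2 := key (Γ.length e - s) (Γ.length e - t)
    rw [show Γ.length e - s - (Γ.length e - t) = t - s by ring, abs_sub_comm t s] at k2
    have m1 := mul_le_mul (hM (Γ.src e)) k1 (abs_nonneg _) ((abs_nonneg _).trans (hM (Γ.src e)))
    have m2 := mul_le_mul (hM (Γ.tgt e)) k2 (abs_nonneg _) ((abs_nonneg _).trans (hM (Γ.src e)))
    rw [← abs_mul] at m1 m2
    calc _ = |a (Γ.src e) * (max 0 (1 - s / r) - max 0 (1 - t / r)) +
          a (Γ.tgt e) * (max 0 (1 - (Γ.length e - s) / r) - max 0 (1 - (Γ.length e - t) / r))| := by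
          congr 1; ring
      _ ≤ _ := abs_add_le _ _
      _ ≤ M * (|s - t| / r) + M * (|s - t| / r) := add_le_add m1 m2
      _ = _ := by ring

/-- The function with a peak of radius `r` at the point `t₀` of the edge `e₀`. -/
noncomputable def interiorBump (e₀ : Γ.E) (t₀ r : ℝ) : Γ.Point → ℝ :=
  open Classical in ofEdges 0 fun e t => if e = e₀ then max 0 (1 - |t - t₀| / r) else 0

lemma edgeLipschitz_interiorBump {e₀ : Γ.E} {t₀ r : ℝ} (hr : 0 < r) (h0 : r ≤ t₀)
    (h1 : r ≤ Γ.length e₀ - t₀) : EdgeLipschitz (1 / r) (interiorBump e₀ t₀ r) := by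
  classical
  refine edgeLipschitz_ofEdges (fun e => ?_) (fun e => ?_) fun e s t => ?_
  · split_ifs with h
    · have : 1 ≤ |0 - t₀| / r := by
        rw [one_le_div hr, zero_sub, abs_neg]; exact h0.trans (le_abs_self _)
      simpa using this
    · rfl
  · split_ifs with h
    · subst h
      have : 1 ≤ |Γ.length e - t₀| / r := by
        rw [one_le_div hr]; exact h1.trans (le_abs_self _)
      simpa using this
    · rfl
  · split_ifs
    · refine (abs_max_zero_sub_le _ _).trans ?_
      rw [show 1 - |s - t₀| / r - (1 - |t - t₀| / r) = (|t - t₀| - |s - t₀|) / r by ring, abs_div,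
        abs_of_pos hr, div_mul_eq_mul_div, one_mul]
      refine div_le_div_of_nonneg_right ?_ hr.le
      refine (abs_abs_sub_abs_le (t - t₀) (s - t₀)).trans_eq ?_
      rw [abs_sub_comm]
      congr 1; ring
    · simp only [sub_self, abs_zero]
      positivity

open Filter in
lemma exists_radius (S : Finset Γ.Point) :
    ∃ r > 0, (∀ e, r ≤ Γ.length e) ∧
      ∀ e t h, Point.interior e t h ∈ S → r ≤ t ∧ r ≤ Γ.length e - t := by
  have key : ∀ y : ℝ, 0 < y → ∀ᶠ r in 𝓝[>] (0 : ℝ), r ≤ y := fun y hy =>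
    (eventually_le_nhds hy).filter_mono nhdsWithin_le_nhds
  have h1 : ∀ᶠ r in 𝓝[>] (0 : ℝ), ∀ e, r ≤ Γ.length e :=
    eventually_all.2 fun e => key _ (Γ.length_pos e)
  have h2 : ∀ᶠ r in 𝓝[>] (0 : ℝ), ∀ p ∈ S, ∀ e t h, p = Point.interior e t h →
      r ≤ t ∧ r ≤ Γ.length e - t := by
    refine (eventually_all_finset S).2 fun p _ => ?_
    rcases p with x | ⟨e, t, ht⟩
    · simp
    · filter_upwards [key t ht.1, key (Γ.length e - t) (sub_pos.2 ht.2)] with r hr hr' e' t' h' heq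
      cases heq
      exact ⟨hr, hr'⟩
  obtain ⟨r, ⟨hr1, hr2⟩, hr0⟩ := ((h1.and h2).and self_mem_nhdsWithin).exists
  exact ⟨r, hr0, hr1, fun e t h hS => hr2 _ hS e t h rfl⟩

lemma vertexBump_interior_eq_zero {a : Γ.V → ℝ} {r : ℝ} (hr : 0 < r) {e : Γ.E} {t : ℝ}
    {h : 0 < t ∧ t < Γ.length e} (h0 : r ≤ t) (h1 : r ≤ Γ.length e - t) :
    vertexBump a r (.interior e t h) = 0 := by
  have h0' : 1 - t / r ≤ 0 := by rwa [sub_nonpos, one_le_div hr]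
  have h1' : 1 - (Γ.length e - t) / r ≤ 0 := by rwa [sub_nonpos, one_le_div hr]
  simp [vertexBump, ofEdges, h0', h1']

lemma vertexBump_nonneg {a : Γ.V → ℝ} (ha : 0 ≤ a) (r : ℝ) : 0 ≤ vertexBump a r := by
  rintro (x | ⟨e, t, ht⟩)
  · exact ha x
  · exact add_nonneg (mul_nonneg (ha _) (le_max_left _ _)) (mul_nonneg (ha _) (le_max_left _ _))

open Filter in
-- Pairing with such a bump reads off one coefficient of a divisor supported in `S`. The bump is
-- Lipschitz, and not merely continuous, because monotonicity arguments control only Lipschitz test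
-- functions.
lemma exists_bump (S : Finset Γ.Point) (p : Γ.Point) :
    ∃ L φ, EdgeLipschitz L φ ∧ 0 ≤ φ ∧ φ p = 1 ∧ ∀ x ∈ S, x ≠ p → φ x = 0 := by
  classical
  rcases p with x | ⟨e, t, ht⟩
  · obtain ⟨r, hr, hl, hS⟩ := exists_radius S
    refine ⟨_, vertexBump (Pi.single x 1) r, edgeLipschitz_vertexBump (M := 1) hr (fun y => ?_) hl,
      vertexBump_nonneg (Pi.single_nonneg.2 zero_le_one) r, ?_, ?_⟩
    · by_cases h : y = x <;> simp [h]
    · simp [vertexBump, ofEdges]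
    · rintro (y | ⟨e, t, ht⟩) hy hne
      · have : y ≠ x := fun h => hne (by rw [h])
        simp [vertexBump, ofEdges, this]
      · exact vertexBump_interior_eq_zero hr (hS e t ht hy).1 (hS e t ht hy).2
  · have key : ∀ y : ℝ, 0 < y → ∀ᶠ r in 𝓝[>] (0 : ℝ), r ≤ y := fun y hy =>
      (eventually_le_nhds hy).filter_mono nhdsWithin_le_nhds
    have h2 : ∀ᶠ r in 𝓝[>] (0 : ℝ), ∀ p ∈ S, ∀ s h, p = Point.interior e s h → s ≠ t →
        r ≤ |s - t| := by
      refine (eventually_all_finset S).2 fun p _ => ?_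
      rcases p with x | ⟨e', s, hs⟩
      · simp
      · by_cases hst : s = t
        · refine .of_forall ?_
          intro r s' h' heq hne
          cases heq
          exact absurd hst hne
        · filter_upwards [key |s - t| (abs_pos.2 (sub_ne_zero.2 hst))] with r hr s' h' heq _
          cases heq
          exact hr
    obtain ⟨r, ⟨⟨hr1, hr2⟩, hr3⟩, hr0⟩ := (((key t ht.1).and
      (key (Γ.length e - t) (sub_pos.2 ht.2))).and h2 |>.and self_mem_nhdsWithin).exists
    refine ⟨_, interiorBump e t r, edgeLipschitz_interiorBump hr0 hr1 hr2, ?_, ?_, ?_⟩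
    · rintro (y | ⟨e', s, hs⟩)
      · exact le_rfl
      · simp only [interiorBump, ofEdges]
        split_ifs
        · exact le_max_left _ _
        · exact le_rfl
    · simp [interiorBump, ofEdges]
    · rintro (y | ⟨e', s, hs⟩) hy hne
      · rfl
      · by_cases h : e' = e
        · subst h
          have hst : s ≠ t := by rintro rfl; exact hne rfl
          have : 1 ≤ |s - t| / r := by
            rw [one_le_div hr0]; exact hr3 _ hy s hs rfl hst
          simpa [interiorBump, ofEdges] using this
        · simp [interiorBump, ofEdges, h]

/-! ### A potential which decreases under firing -/

/-- The flow of the gradient of `a` out of the vertex `x`. -/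
noncomputable def outflow (a : Γ.V → ℝ) (x : Γ.V) : ℝ :=
  open Classical in ∑ e, ((if Γ.src e = x then 1 else 0) - (if Γ.tgt e = x then 1 else 0)) *
    ((a (Γ.src e) - a (Γ.tgt e)) / Γ.length e)

/-- Summation by parts. With `b = a` it gives the Dirichlet energy, with `b` the indicator of a set
the flow across its cut. -/
lemma sum_mul_outflow (a b : Γ.V → ℝ) :
    ∑ x, b x * outflow a x =
      ∑ e, (b (Γ.src e) - b (Γ.tgt e)) * ((a (Γ.src e) - a (Γ.tgt e)) / Γ.length e) := by
  classical
  simp only [outflow, Finset.mul_sum]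
  rw [Finset.sum_comm]
  refine Finset.sum_congr rfl fun e _ => ?_
  simp only [← mul_assoc, ← Finset.sum_mul, mul_sub, Finset.sum_sub_distrib]
  simp

lemma eq_of_forall_edge {a : Γ.V → ℝ} (h : ∀ e, a (Γ.src e) = a (Γ.tgt e)) (x y : Γ.V) :
    a x = a y := by
  obtain ⟨p⟩ := Γ.connected.preconnected x y
  induction p with
  | nil => rfl
  | cons hadj _ ih =>
    refine Eq.trans ?_ ih
    rcases hadj.2 with ⟨e, rfl, rfl⟩ | ⟨e, rfl, rfl⟩
    · exact h e
    · exact (h e).symm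

/-- A function that vanishes at `q` and has no outflow elsewhere has zero Dirichlet energy, so it is
constant by connectedness, hence zero. Injectivity gives surjectivity in finite dimension. -/
lemma exists_outflow_eq_one (Γ : MetricGraph.{u, v}) (q : Γ.V) :
    ∃ a : Γ.V → ℝ, ∀ x ≠ q, outflow a x = 1 := by
  classical
  -- The equation at `q` is replaced by the value at `q`, which removes the constants from the
  -- kernel of the Laplacian.
  let T : (Γ.V → ℝ) →ₗ[ℝ] (Γ.V → ℝ) :=
    { toFun := fun a x => if x = q then a q else outflow a x
      map_add' := fun a b => by
        ext x
        by_cases h : x = q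
        · simp [h]
        · simp only [h, if_false, Pi.add_apply, outflow, ← Finset.sum_add_distrib]
          exact Finset.sum_congr rfl fun e _ => by ring
      map_smul' := fun c a => by
        ext x
        by_cases h : x = q
        · simp [h]
        · simp only [h, if_false, Pi.smul_apply, outflow, smul_eq_mul, Finset.mul_sum,
            RingHom.id_apply]
          exact Finset.sum_congr rfl fun e _ => by ring }
  have hT : Function.Injective T := by
    rw [← LinearMap.ker_eq_bot, LinearMap.ker_eq_bot']
    intro a ha
    have hx : ∀ x, (if x = q then a q else outflow a x) = 0 := fun x => congrFun ha x
    have hq : a q = 0 := by simpa using hx q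
    have hsum : ∑ x, a x * outflow a x = 0 := by
      refine Finset.sum_eq_zero fun x _ => ?_
      by_cases h : x = q
      · rw [h, hq, zero_mul]
      · have := hx x
        rw [if_neg h] at this
        rw [this, mul_zero]
    rw [sum_mul_outflow, Finset.sum_eq_zero_iff_of_nonneg fun e _ => by
      rw [← mul_div_assoc]
      exact div_nonneg (mul_self_nonneg _) (Γ.length_pos e).le] at hsum
    ext x
    rw [eq_of_forall_edge (a := a) (fun e => ?_) x q, hq]
    · rfl
    · have := hsum e (Finset.mem_univ e)
      rw [← mul_div_assoc, div_eq_zero_iff, mul_self_eq_zero] at this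
      exact sub_eq_zero.1 (this.resolve_right (Γ.length_pos e).ne')
  obtain ⟨a, ha⟩ := LinearMap.injective_iff_surjective.1 hT 1
  refine ⟨a, fun x hx => ?_⟩
  have : (if x = q then a q else outflow a x) = 1 := congrFun ha x
  rwa [if_neg hx] at this

/-- The function which is linear on the edges with given values at the vertices. -/
noncomputable def linearExtension (a : Γ.V → ℝ) : Γ.Point → ℝ :=
  ofEdges a fun e t => a (Γ.src e) - t * ((a (Γ.src e) - a (Γ.tgt e)) / Γ.length e)

lemma linearExtension_pt (a : Γ.V → ℝ) {e : Γ.E} {t : ℝ} (ht : t ∈ Set.Icc 0 (Γ.length e)) :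
    linearExtension a (Γ.pt e t) =
      a (Γ.src e) - t * ((a (Γ.src e) - a (Γ.tgt e)) / Γ.length e) :=
  ofEdges_pt (g := fun e t => a (Γ.src e) - t * ((a (Γ.src e) - a (Γ.tgt e)) / Γ.length e))
    (by simp) (by have := (Γ.length_pos e).ne'; field_simp; ring) ht

lemma exists_edgeLipschitz_linearExtension (a : Γ.V → ℝ) :
    ∃ L, EdgeLipschitz L (linearExtension a) := by
  refine ⟨∑ e, |(a (Γ.src e) - a (Γ.tgt e)) / Γ.length e|, fun e s hs t ht => ?_⟩
  rw [linearExtension_pt a hs, linearExtension_pt a ht, sub_sub_sub_cancel_left, ← sub_mul,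
    abs_mul, mul_comm, abs_sub_comm]
  exact mul_le_mul_of_nonneg_right (Finset.single_le_sum (f := fun e =>
    |(a (Γ.src e) - a (Γ.tgt e)) / Γ.length e|) (fun _ _ => abs_nonneg _) (Finset.mem_univ e))
    (abs_nonneg _)

/-! ### Points on the edges of a cut -/

lemma mem_cut {A : Set Γ.V} {e : Γ.E} : e ∈ cut A ↔ ¬ (Γ.src e ∈ A ↔ Γ.tgt e ∈ A) := by
  simp [cut]

section ptFrom

variable {A : Set Γ.V} {e e' : Γ.E} {s t : ℝ}

lemma ptFrom_zero (he : e ∈ cut A) : ∃ x ∈ A, ptFrom A e 0 = .vertex x := by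
  rw [mem_cut] at he
  by_cases h : Γ.src e ∈ A
  · exact ⟨_, h, by simp [ptFrom, h, pt_zero]⟩
  · exact ⟨Γ.tgt e, by tauto, by simp [ptFrom, h, pt_length]⟩

lemma ptFrom_length (he : e ∈ cut A) : ∃ x ∉ A, ptFrom A e (Γ.length e) = .vertex x := by
  rw [mem_cut] at he
  by_cases h : Γ.src e ∈ A
  · exact ⟨Γ.tgt e, by tauto, by simp [ptFrom, h, pt_length]⟩
  · exact ⟨_, h, by simp [ptFrom, h, pt_zero]⟩

open Classical in
lemma ptFrom_interior (ht : 0 < t) (ht' : t < Γ.length e) :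
    ∃ h, ptFrom A e t = .interior e (if Γ.src e ∈ A then t else Γ.length e - t) h := by
  have h : 0 < (if Γ.src e ∈ A then t else Γ.length e - t) ∧
      (if Γ.src e ∈ A then t else Γ.length e - t) < Γ.length e := by
    split_ifs
    · exact ⟨ht, ht'⟩
    · constructor <;> linarith
  refine ⟨h, ?_⟩
  rw [← pt_of_mem h, ptFrom]
  split_ifs <;> rfl

lemma mem_of_ptFrom_eq_vertex (he : e ∈ cut A) (h0 : 0 ≤ t) (h1 : t < Γ.length e) {x : Γ.V}
    (h : ptFrom A e t = .vertex x) : x ∈ A := by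
  rcases h0.eq_or_lt with rfl | h0
  · obtain ⟨y, hy, hy'⟩ := ptFrom_zero he
    rw [hy'] at h
    cases h
    exact hy
  · obtain ⟨_, h'⟩ := ptFrom_interior (A := A) h0 h1
    rw [h'] at h
    cases h

/-- The asymmetric half-open ranges are those of starting points and end points: a starting point
can be a vertex only in `A`, an end point only outside `A`. -/
lemma ptFrom_ne_ptFrom (he : e ∈ cut A) (he' : e' ∈ cut A) (hs : 0 ≤ s) (hs' : s < Γ.length e)
    (ht : 0 < t) (ht' : t ≤ Γ.length e') (hst : e = e' → s ≠ t) : ptFrom A e s ≠ ptFrom A e' t := by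
  intro h
  rcases ht'.eq_or_lt with rfl | ht'
  · obtain ⟨x, hx, hx'⟩ := ptFrom_length he'
    exact hx (mem_of_ptFrom_eq_vertex he hs hs' (h.trans hx'))
  obtain ⟨_, h'⟩ := ptFrom_interior (A := A) ht ht'
  rcases hs.eq_or_lt with rfl | hs
  · obtain ⟨x, _, hx'⟩ := ptFrom_zero he
    rw [hx', h'] at h
    cases h
  obtain ⟨_, h''⟩ := ptFrom_interior (A := A) hs hs'
  rw [h', h''] at h
  obtain ⟨rfl, h2⟩ := Point.interior.inj h
  refine hst rfl ?_
  split_ifs at h2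
  · exact h2
  · linarith

lemma EdgeLipschitz.abs_ptFrom_sub_le {L : ℝ} {φ : Γ.Point → ℝ} (h : EdgeLipschitz L φ)
    (A : Set Γ.V) (hs : s ∈ Set.Icc 0 (Γ.length e)) (ht : t ∈ Set.Icc 0 (Γ.length e)) :
    |φ (ptFrom A e s) - φ (ptFrom A e t)| ≤ L * |s - t| := by
  unfold ptFrom
  split_ifs
  · exact h e s hs t ht
  · refine (h e _ ⟨?_, ?_⟩ _ ⟨?_, ?_⟩).trans_eq ?_
    any_goals linarith [hs.1, hs.2, ht.1, ht.2]
    rw [sub_sub_sub_cancel_left, abs_sub_comm]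

open Classical in
lemma linearExtension_ptFrom_sub (a : Γ.V → ℝ) (he : e ∈ cut A) (hs : s ∈ Set.Icc 0 (Γ.length e))
    (ht : t ∈ Set.Icc 0 (Γ.length e)) :
    linearExtension a (ptFrom A e s) - linearExtension a (ptFrom A e t) =
      (t - s) * (((if Γ.src e ∈ A then 1 else 0) - (if Γ.tgt e ∈ A then 1 else 0)) *
        ((a (Γ.src e) - a (Γ.tgt e)) / Γ.length e)) := by
  rw [mem_cut] at he
  unfold ptFrom
  by_cases h : Γ.src e ∈ A
  · have h' : Γ.tgt e ∉ A := by tauto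
    simp only [h, h', if_true, if_false]
    rw [linearExtension_pt a hs, linearExtension_pt a ht]
    ring
  · have h' : Γ.tgt e ∈ A := by tauto
    simp only [h, h', if_true, if_false]
    rw [linearExtension_pt a, linearExtension_pt a]
    · ring
    all_goals constructor <;> linarith [hs.1, hs.2, ht.1, ht.2]

end ptFrom

/-! ### Firings -/

namespace Firing

variable {q : Γ.V} (f : Γ.Firing q)

lemma start_lt {e : Γ.E} (he : e ∈ cut f.side) : f.start e < Γ.length e := by
  linarith [f.len_pos, f.start_add_len_le e he]

lemma start_mem {e : Γ.E} (he : e ∈ cut f.side) : f.start e ∈ Set.Icc 0 (Γ.length e) :=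
  ⟨f.start_nonneg e he, (f.start_lt he).le⟩

lemma start_add_len_mem {e : Γ.E} (he : e ∈ cut f.side) :
    f.start e + f.len ∈ Set.Icc 0 (Γ.length e) :=
  ⟨by linarith [f.len_pos, f.start_nonneg e he], f.start_add_len_le e he⟩

lemma pairing_div (φ : Γ.Point → ℝ) :
    pairing f.div φ = ∑ e ∈ cut f.side,
      (φ (ptFrom f.side e (f.start e)) - φ (ptFrom f.side e (f.start e + f.len))) := by
  simp [div, pairing_eq_linearCombination]

lemma degree_div : degree f.div = 0 := by
  have := f.pairing_div fun _ => 1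
  simp only [pairing_const, mul_one, sub_self, Finset.sum_const_zero] at this
  exact_mod_cast this

lemma abs_pairing_div_le {L : ℝ} {φ : Γ.Point → ℝ} (h : EdgeLipschitz L φ) :
    |pairing f.div φ| ≤ Fintype.card Γ.E * |L| * f.len := by
  rw [pairing_div]
  refine (Finset.abs_sum_le_sum_abs _ _).trans ?_
  refine (Finset.sum_le_card_nsmul _ _ (|L| * f.len) fun e he => ?_).trans ?_
  · refine (h.abs_ptFrom_sub_le f.side (f.start_mem he) (f.start_add_len_mem he)).trans ?_
    rw [sub_add_cancel_left, abs_neg, abs_of_pos f.len_pos]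
    exact mul_le_mul_of_nonneg_right (le_abs_self L) f.len_pos.le
  · rw [nsmul_eq_mul, mul_assoc]
    have := mul_nonneg (abs_nonneg L) f.len_pos.le
    gcongr
    exact Finset.card_le_univ _

/-- The slopes across the cut add up to the total outflow of `side`, which is its number of vertices
because `q` is not among them. -/
lemma len_le_pairing_div {a : Γ.V → ℝ} (ha : ∀ x ≠ q, outflow a x = 1) :
    f.len ≤ pairing f.div (linearExtension a) := by
  classical
  have h1 : pairing f.div (linearExtension a) =
      f.len * ∑ x, (if x ∈ f.side then 1 else 0) * outflow a x := by
    rw [pairing_div, sum_mul_outflow, Finset.mul_sum]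
    refine (Finset.sum_congr rfl fun e he => ?_).trans
      (Finset.sum_subset (Finset.subset_univ _) fun e _ he => ?_)
    · rw [linearExtension_ptFrom_sub a he (f.start_mem he) (f.start_add_len_mem he),
        add_sub_cancel_left]
    · rw [mem_cut, not_not] at he
      simp [he]
  obtain ⟨x, hx⟩ := f.connected_side.nonempty
  have hside : ∀ y, 0 ≤ (if y ∈ f.side then 1 else 0) * outflow a y := fun y => by
    split_ifs with hy
    · rw [ha y fun h => f.q_notMem (h ▸ hy)]; norm_num
    · simp
  have h2 : 1 ≤ ∑ x, (if x ∈ f.side then 1 else 0) * outflow a x := by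
    refine le_trans ?_ (Finset.single_le_sum (fun y _ => hside y) (Finset.mem_univ x))
    rw [ha x fun h => f.q_notMem (h ▸ hx), if_pos hx, mul_one]
  rw [h1]
  exact le_mul_of_one_le_right f.len_pos.le h2

lemma cut_nonempty : (cut f.side).Nonempty := by
  obtain ⟨a, ha⟩ := exists_outflow_eq_one Γ q
  by_contra h
  have := f.len_le_pairing_div ha
  rw [pairing_div, Finset.not_nonempty_iff_eq_empty.1 h, Finset.sum_empty] at this
  exact this.not_gt f.len_pos

/-- The divisor of the starting points. -/
noncomputable def starts : Γ.Divisor :=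
  ∑ e ∈ cut f.side, Finsupp.single (ptFrom f.side e (f.start e)) 1

/-- The divisor of the end points. -/
noncomputable def ends : Γ.Divisor :=
  ∑ e ∈ cut f.side, Finsupp.single (ptFrom f.side e (f.start e + f.len)) 1

lemma div_eq : f.div = f.starts - f.ends := Finset.sum_sub_distrib ..

lemma starts_nonneg : 0 ≤ f.starts :=
  Finset.sum_nonneg fun _ _ => Finsupp.single_nonneg.2 zero_le_one

lemma ends_nonneg : 0 ≤ f.ends :=
  Finset.sum_nonneg fun _ _ => Finsupp.single_nonneg.2 zero_le_one

lemma one_le_starts {e : Γ.E} (he : e ∈ cut f.side) :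
    1 ≤ f.starts (ptFrom f.side e (f.start e)) := by
  have h : Finsupp.single (ptFrom f.side e (f.start e)) 1 ≤ f.starts :=
    Finset.single_le_sum (f := fun e => (Finsupp.single (ptFrom f.side e (f.start e)) 1 :
      Γ.Divisor)) (fun _ _ => Finsupp.single_nonneg.2 zero_le_one) he
  simpa using h (ptFrom f.side e (f.start e))

lemma one_le_ends {e : Γ.E} (he : e ∈ cut f.side) :
    1 ≤ f.ends (ptFrom f.side e (f.start e + f.len)) := by
  have h : Finsupp.single (ptFrom f.side e (f.start e + f.len)) 1 ≤ f.ends :=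
    Finset.single_le_sum (f := fun e => (Finsupp.single (ptFrom f.side e (f.start e + f.len)) 1 :
      Γ.Divisor)) (fun _ _ => Finsupp.single_nonneg.2 zero_le_one) he
  simpa using h (ptFrom f.side e (f.start e + f.len))

lemma starts_eq_zero {p : Γ.Point} (h : ∀ e ∈ cut f.side, ptFrom f.side e (f.start e) ≠ p) :
    f.starts p = 0 := by
  rw [starts, Finsupp.finsetSum_apply]
  exact Finset.sum_eq_zero fun e he => Finsupp.single_eq_of_ne (h e he).symm

lemma ends_eq_zero {p : Γ.Point}
    (h : ∀ e ∈ cut f.side, ptFrom f.side e (f.start e + f.len) ≠ p) : f.ends p = 0 := by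
  rw [ends, Finsupp.finsetSum_apply]
  exact Finset.sum_eq_zero fun e he => Finsupp.single_eq_of_ne (h e he).symm

lemma starts_vertex_eq_zero {x : Γ.V} (hx : x ∉ f.side) : f.starts (.vertex x) = 0 :=
  f.starts_eq_zero fun e he h =>
    hx (mem_of_ptFrom_eq_vertex he (f.start_nonneg e he) (f.start_lt he) h)

lemma starts_eq_zero_or_ends_eq_zero (p : Γ.Point) : f.starts p = 0 ∨ f.ends p = 0 := by
  by_contra! h
  have h1 : ∃ e ∈ cut f.side, ptFrom f.side e (f.start e) = p := by
    by_contra! h'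
    exact h.1 (f.starts_eq_zero h')
  have h2 : ∃ e ∈ cut f.side, ptFrom f.side e (f.start e + f.len) = p := by
    by_contra! h'
    exact h.2 (f.ends_eq_zero h')
  obtain ⟨e, he, rfl⟩ := h1
  obtain ⟨e', he', h⟩ := h2
  refine ptFrom_ne_ptFrom he he' (f.start_nonneg e he) (f.start_lt he) ?_
    (f.start_add_len_le e' he') ?_ h.symm
  · linarith [f.len_pos, f.start_nonneg e' he']
  · rintro rfl
    exact (lt_add_of_pos_right _ f.len_pos).ne

variable {f} {D : Γ.Divisor}

/-- No point is both a starting point and an end point, so arriving chips never pay for departing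
ones. Legality is therefore independent of `len`. -/
lemma legal_iff (hD : NonnegAway q D) :
    f.Legal D ↔ ∀ p, p ≠ .vertex q → f.starts p ≤ D p := by
  refine forall₂_congr fun p hp => ?_
  rw [div_eq]
  have h0 := hD p hp
  have h1 : 0 ≤ f.starts p := f.starts_nonneg p
  have h2 : 0 ≤ f.ends p := f.ends_nonneg p
  simp only [Finsupp.sub_apply]
  rcases f.starts_eq_zero_or_ends_eq_zero p with h | h <;> omega

lemma Legal.one_le_start (hD : NonnegAway q D) (h : f.Legal D) {e : Γ.E} (he : e ∈ cut f.side) :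
    1 ≤ D (ptFrom f.side e (f.start e)) := by
  refine (f.one_le_starts he).trans ((legal_iff hD).1 h _ fun h' => ?_)
  exact f.q_notMem (mem_of_ptFrom_eq_vertex he (f.start_nonneg e he) (f.start_lt he) h')

/-- The firing along the same cut from the same starting points, of maximal length. -/
lemma exists_maximal (f : Γ.Firing q) : ∃ g : Γ.Firing q, g.side = f.side ∧ g.start = f.start ∧
    (∃ e ∈ cut f.side, g.start e + g.len = Γ.length e) := by
  obtain ⟨e, he, hmin⟩ := Finset.exists_min_image (cut f.side)
    (fun e => Γ.length e - f.start e) f.cut_nonempty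
  exact ⟨{ f with
    len := Γ.length e - f.start e
    len_pos := sub_pos.2 (f.start_lt he)
    start_add_len_le := fun e' he' => by linarith [hmin e' he'] }, rfl, rfl, e, he, by simp⟩

lemma starts_congr {f g : Γ.Firing q} (h : g.side = f.side)
    (h' : ∀ e ∈ cut f.side, g.start e = f.start e) : g.starts = f.starts := by
  rw [starts, starts, h]
  exact Finset.sum_congr rfl fun e he => by rw [h' e he]

/-- Lengthening a firing preserves legality, so only the end of an edge can stop it. -/
lemma MaximalLegal.exists_reaches (hD : NonnegAway q D) (h : f.MaximalLegal D) :
    ∃ e ∈ cut f.side, f.start e + f.len = Γ.length e := by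
  obtain ⟨g, hs, hst, e, he, hg⟩ := f.exists_maximal
  have := h.2 g hs (fun e _ => by rw [hst]) ((legal_iff hD).2 (by
    rw [starts_congr hs fun e _ => by rw [hst]]
    exact (legal_iff hD).1 h.1))
  refine ⟨e, he, le_antisymm (f.start_add_len_le e he) ?_⟩
  rw [hst] at hg
  linarith

lemma Legal.exists_maximalLegal (hD : NonnegAway q D) (h : f.Legal D) :
    ∃ g : Γ.Firing q, g.MaximalLegal D := by
  obtain ⟨g, hs, hst, e, he, hg⟩ := f.exists_maximal
  refine ⟨g, (legal_iff hD).2 ?_, fun g' hs' hst' _ => ?_⟩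
  · rw [starts_congr hs fun e _ => by rw [hst]]
    exact (legal_iff hD).1 h
  · rw [← hs] at he
    have := g'.start_add_len_le e (hs' ▸ he)
    rw [hst' e he] at this
    linarith

lemma Legal.single_le (h : f.Legal D) {c : ℤ} (hD : Finsupp.single (.vertex q) c ≤ D) :
    Finsupp.single (.vertex q) c ≤ D - f.div := by
  intro p
  by_cases hp : p = .vertex q
  · subst hp
    have h1 := hD (.vertex q)
    have h2 : 0 ≤ f.ends (.vertex q) := f.ends_nonneg _
    have h3 := f.starts_vertex_eq_zero f.q_notMem
    simp only [div_eq, Finsupp.sub_apply, Finsupp.single_eq_same] at h1 ⊢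
    omega
  · rw [Finsupp.single_eq_of_ne hp]
    exact h p hp

/-- The arriving chip lands on a vertex outside `side`, from which no chip departs. Subtracting `c`
chips at `q` leaves a nonnegative divisor, so this chip counts on top of `c`. -/
lemma MaximalLegal.lt_vertexChips {c : ℤ} (hD : NonnegAway q D) (h : f.MaximalLegal D)
    (hc : Finsupp.single (.vertex q) c ≤ D) : c + 1 ≤ vertexChips (D - f.div) := by
  obtain ⟨e, he, hlen⟩ := h.exists_reaches hD
  obtain ⟨x, hx, hx'⟩ := ptFrom_length he
  have h1 := f.one_le_ends he
  rw [hlen, hx'] at h1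
  have h2 := f.starts_vertex_eq_zero hx
  have h3 := hc (.vertex x)
  have h4 := h.1.single_le hc
  have h5 : (D - f.div - Finsupp.single (Point.vertex q) c) (.vertex x) ≤
      vertexChips (D - f.div - Finsupp.single (Point.vertex q) c) :=
    Finset.single_le_sum (f := fun x => (D - f.div - Finsupp.single (Point.vertex q) c) (.vertex x))
      (fun y _ => sub_nonneg.2 h4 (.vertex y)) (Finset.mem_univ x)
  rw [vertexChips_sub _ (Finsupp.single _ _), vertexChips_single] at h5
  simp only [div_eq, Finsupp.sub_apply] at h5 ⊢
  omega

end Firing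

lemma nonnegAway_of_single_le {q : Γ.V} {c : ℤ} {D : Γ.Divisor}
    (h : Finsupp.single (.vertex q) c ≤ D) : NonnegAway q D := fun p hp => by
  simpa [Finsupp.single_eq_of_ne hp] using h p

lemma single_le_of_nonnegAway {q : Γ.V} {D : Γ.Divisor} (h : NonnegAway q D) :
    Finsupp.single (.vertex q) (D (.vertex q)) ≤ D := fun p => by
  by_cases hp : p = .vertex q
  · simp [hp]
  · simpa [Finsupp.single_eq_of_ne hp] using h p hp

open Filter

/-! ### Limits of divisors -/

section DivisorTendsto

variable {ι : Type*} {F : Filter ι} {q : Γ.V} {c d : ℤ}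

lemma exists_eq_sum_single (n : ℕ) {D : Γ.Divisor} (hD : 0 ≤ D) (hn : degree D = n) :
    ∃ x : Fin n → Γ.Point, D = ∑ k, Finsupp.single (x k) 1 := by
  induction n generalizing D with
  | zero =>
    refine ⟨Fin.elim0, ?_⟩
    ext p
    have h1 := apply_le_degree hD p
    have h2 : 0 ≤ D p := hD p
    simp only [Finset.univ_eq_empty, Finset.sum_empty, Finsupp.coe_zero, Pi.zero_apply]
    push_cast at hn
    omega
  | succ n ih =>
    obtain ⟨p, hp⟩ : ∃ p, 1 ≤ D p := by
      by_contra! h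
      have : D = 0 := by
        ext p
        have h2 : 0 ≤ D p := hD p
        have := h p
        simp only [Finsupp.coe_zero, Pi.zero_apply]
        omega
      rw [this] at hn
      simp only [degree, Finsupp.sum_zero_index] at hn
      omega
    obtain ⟨x, hx⟩ := ih (D := D - Finsupp.single p 1) (fun y => by
        classical
        rw [Finsupp.sub_apply, Finsupp.single_apply]
        split_ifs with h
        · subst h
          exact sub_nonneg.2 hp
        · rw [sub_zero]; exact hD y)
      (by rw [degree_sub, degree_single, hn]; push_cast; ring)
    refine ⟨Fin.cons p x, ?_⟩
    rw [Fin.sum_univ_succ]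
    simp only [Fin.cons_zero, Fin.cons_succ, ← hx]
    abel

/-- After removing `c` chips at `q`, each divisor is a tuple of `d - c` points of a compact space,
and each coordinate converges along the ultrafilter. -/
lemma exists_divisorTendsto_ultrafilter (U : Ultrafilter ι) {D : ι → Γ.Divisor}
    (h : ∀ᶠ i in U, Finsupp.single (.vertex q) c ≤ D i ∧ degree (D i) = d) :
    ∃ D', DivisorTendsto D U D' := by
  classical
  obtain ⟨n, hn⟩ : ∃ n : ℕ, d - c = n := by
    obtain ⟨i, hi, hi'⟩ := h.exists
    have := degree_nonneg (sub_nonneg.2 hi)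
    rw [degree_sub, degree_single, hi'] at this
    exact ⟨(d - c).toNat, by omega⟩
  have h' : ∀ i, ∃ x : Fin n → Γ.Point,
      Finsupp.single (.vertex q) c ≤ D i ∧ degree (D i) = d →
        D i - Finsupp.single (.vertex q) c = ∑ k, Finsupp.single (x k) 1 := by
    intro i
    by_cases hi : Finsupp.single (.vertex q) c ≤ D i ∧ degree (D i) = d
    · obtain ⟨x, hx⟩ := exists_eq_sum_single n (sub_nonneg.2 hi.1)
        (by rw [degree_sub, degree_single, hi.2, hn])
      exact ⟨x, fun _ => hx⟩
    · exact ⟨fun _ => .vertex q, fun h => absurd h hi⟩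
  choose x hx using h'
  have hlim : ∀ k, ∃ p, Tendsto (fun i => x i k) U (𝓝 p) := fun k => by
    obtain ⟨p, -, hp⟩ := isCompact_univ.ultrafilter_le_nhds (U.map fun i => x i k) (by simp)
    exact ⟨p, hp⟩
  choose p hp using hlim
  refine ⟨Finsupp.single (.vertex q) c + ∑ k, Finsupp.single (p k) 1, fun φ hφ => ?_⟩
  have hT : Tendsto (fun i => c * φ (.vertex q) + ∑ k, φ (x i k)) U
      (𝓝 (c * φ (.vertex q) + ∑ k, φ (p k))) :=
    tendsto_const_nhds.add (tendsto_finsetSum _ fun k _ => (hφ.tendsto _).comp (hp k))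
  refine (hT.congr' ?_).trans (le_of_eq ?_)
  · filter_upwards [h] with i hi
    rw [eq_add_of_sub_eq' (hx i hi)]
    simp [pairing_eq_linearCombination]
  · simp [pairing_eq_linearCombination]

lemma eq_of_pairing_eq {D D' : Γ.Divisor}
    (h : ∀ L φ, EdgeLipschitz L φ → pairing D φ = pairing D' φ) : D = D' := by
  classical
  ext p
  obtain ⟨L, φ, hL, -, hp, hφ⟩ := exists_bump (D.support ∪ D'.support) p
  have := h L φ hL
  rw [pairing_eq_apply hp fun x hx => hφ x (Finset.mem_union_left _ hx),
    pairing_eq_apply hp fun x hx => hφ x (Finset.mem_union_right _ hx)] at this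
  exact_mod_cast this

/-- Limits along all finer ultrafilters exist by compactness and agree on Lipschitz functions, which
separate divisors. So they coincide, which gives convergence against every continuous function. -/
lemma exists_divisorTendsto [F.NeBot] {D : ι → Γ.Divisor}
    (h : ∀ᶠ i in F, Finsupp.single (.vertex q) c ≤ D i ∧ degree (D i) = d)
    (hconv : ∀ L φ, EdgeLipschitz L φ → ∃ y, Tendsto (fun i => pairing (D i) φ) F (𝓝 y)) :
    ∃ D', DivisorTendsto D F D' := by
  obtain ⟨D', hD'⟩ := exists_divisorTendsto_ultrafilter (Ultrafilter.of F)
    (h.filter_mono (Ultrafilter.of_le F))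
  refine ⟨D', fun φ hφ => (tendsto_iff_ultrafilter _ _ _).2 fun U hU => ?_⟩
  obtain ⟨D'', hD''⟩ := exists_divisorTendsto_ultrafilter U (h.filter_mono hU)
  suffices D'' = D' from this ▸ hD'' φ hφ
  refine eq_of_pairing_eq fun L ψ hψ => ?_
  obtain ⟨y, hy⟩ := hconv L ψ hψ
  rw [tendsto_nhds_unique (hD'' ψ hψ.continuous) (hy.mono_left hU),
    tendsto_nhds_unique (hD' ψ hψ.continuous) (hy.mono_left (Ultrafilter.of_le F))]

lemma DivisorTendsto.single_le [F.NeBot] {D : ι → Γ.Divisor} {D' : Γ.Divisor}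
    (hD : DivisorTendsto D F D') (h : ∀ᶠ i in F, Finsupp.single (.vertex q) c ≤ D i) :
    Finsupp.single (.vertex q) c ≤ D' := by
  classical
  intro p
  -- Inserting `q` makes the bump vanish there when `p` is another point, so a debt at `q` does not
  -- disturb the comparison.
  obtain ⟨L, φ, hL, h0, hp, hφ⟩ := exists_bump (insert (.vertex q) D'.support) p
  have hlim := hD φ hL.continuous
  rw [pairing_eq_apply hp fun x hx => hφ x (Finset.mem_insert_of_mem hx)] at hlim
  have hle : c * φ (.vertex q) ≤ D' p := by
    refine ge_of_tendsto hlim ?_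
    filter_upwards [h] with i hi
    rw [← pairing_single]
    exact pairing_mono_left hi h0
  by_cases hpq : p = .vertex q
  · subst hpq
    rw [hp, mul_one] at hle
    rw [Finsupp.single_eq_same]
    exact_mod_cast hle
  · rw [hφ _ (Finset.mem_insert_self _ _) (Ne.symm hpq), mul_zero] at hle
    rw [Finsupp.single_eq_of_ne hpq]
    exact_mod_cast hle

lemma DivisorTendsto.degree_eq [F.NeBot] {D : ι → Γ.Divisor} {D' : Γ.Divisor}
    (hD : DivisorTendsto D F D') (h : ∀ᶠ i in F, degree (D i) = d) : degree D' = d := by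
  have hlim := hD (fun _ => 1) continuous_const
  simp only [pairing_const, mul_one] at hlim
  have hd : Tendsto (fun i => (degree (D i) : ℝ)) F (𝓝 d) :=
    tendsto_const_nhds.congr' (h.mono fun i hi => by simp [hi])
  exact_mod_cast tendsto_nhds_unique hlim hd

lemma abs_pairing_le {D : Γ.Divisor} (hD : Finsupp.single (.vertex q) c ≤ D)
    {φ : Γ.Point → ℝ} {M : ℝ} (hM : ∀ p, |φ p| ≤ M) :
    |pairing D φ| ≤ (degree D - c) * M + |c * φ (.vertex q)| := by
  have h0 := sub_nonneg.2 hD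
  have h1 := pairing_mono_right h0 (φ := φ) (φ' := fun _ => M) fun p => (abs_le.1 (hM p)).2
  have h2 := pairing_mono_right h0 (φ := fun _ => -M) (φ' := φ) fun p => (abs_le.1 (hM p)).1
  rw [pairing_const, pairing_sub, degree_sub, degree_single, pairing_single] at h1 h2
  push_cast at h1 h2
  have h3 := le_abs_self (c * φ (.vertex q))
  have h4 := neg_abs_le (c * φ (.vertex q))
  rw [abs_le]
  constructor <;> linarith

end DivisorTendsto

/-! ### Transfinite sequences -/

lemma nhdsLT_neBot_of_isSuccLimit {l : Ordinal.{w}} (hl : Order.IsSuccLimit l) :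
    (𝓝[<] l).NeBot := by
  refine neBot_iff.2 fun h => ?_
  have h0 : (∅ : Set Ordinal) ∈ 𝓝[<] l := by rw [h]; trivial
  obtain ⟨a, ha, h⟩ := (mem_nhdsLT_iff_exists_Ioo_subset' hl.bot_lt).1 h0
  exact h ⟨Order.lt_succ a, hl.succ_lt ha⟩

lemma antitoneOn_of_succ_le_of_tendsto {h : Ordinal.{w} → ℝ} {β : Ordinal.{w}}
    (hs : ∀ α < β, h (Order.succ α) ≤ h α)
    (hl : ∀ l ≤ β, Order.IsSuccLimit l → Tendsto h (𝓝[<] l) (𝓝 (h l))) :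
    AntitoneOn h (Set.Iic β) := by
  intro a _ b hb hab
  induction b using Ordinal.limitRecOn with
  | zero => rw [le_antisymm hab zero_le]
  | add_one b ih =>
    rw [← Order.succ_eq_add_one] at hab hb ⊢
    rcases hab.eq_or_lt with rfl | hab
    · exact le_rfl
    have hb' : b < β := (Order.lt_succ b).trans_le hb
    exact (hs b hb').trans (ih hb'.le (Order.lt_succ_iff.1 hab))
  | limit b hlim ih =>
    rcases hab.eq_or_lt with rfl | hab
    · exact le_rfl
    have := nhdsLT_neBot_of_isSuccLimit hlim
    refine le_of_tendsto (hl b hb hlim) ?_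
    filter_upwards [Ioo_mem_nhdsLT hab] with x hx
    exact ih x hx.2 (hx.2.le.trans hb) hx.1.le

/-! ### Greedy reductions -/

namespace IsGreedyReduction

variable {q : Γ.V} {D₀ : Γ.Divisor} {β : Ordinal.{w}} {D : Ordinal.{w} → Γ.Divisor}

lemma mono (h : IsGreedyReduction q D₀ β D) {γ : Ordinal.{w}} (hγ : γ ≤ β) :
    IsGreedyReduction q D₀ γ D :=
  ⟨h.zero, fun α hα => h.succ α (hα.trans_le hγ), fun l hl => h.limit l (hl.trans hγ)⟩

lemma single_le_and_degree_eq (hD₀ : NonnegAway q D₀) (h : IsGreedyReduction q D₀ β D) :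
    Finsupp.single (.vertex q) (D₀ (.vertex q)) ≤ D β ∧ degree (D β) = degree D₀ := by
  induction β using Ordinal.limitRecOn with
  | zero => rw [h.zero]; exact ⟨single_le_of_nonnegAway hD₀, rfl⟩
  | add_one b ih =>
    rw [← Order.succ_eq_add_one] at h ⊢
    obtain ⟨f, hf, hb⟩ := h.succ b (Order.lt_succ b)
    obtain ⟨h1, h2⟩ := ih (h.mono (Order.le_succ b))
    rw [hb]
    exact ⟨hf.1.single_le h1, by rw [degree_sub, f.degree_div, h2, sub_zero]⟩
  | limit b hlim ih =>
    have := nhdsLT_neBot_of_isSuccLimit hlim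
    have hev : ∀ᶠ α in 𝓝[<] b, Finsupp.single (.vertex q) (D₀ (.vertex q)) ≤ D α ∧
        degree (D α) = degree D₀ := by
      filter_upwards [self_mem_nhdsWithin] with α hα
      exact ih α hα (h.mono (le_of_lt hα))
    exact ⟨(h.limit b le_rfl hlim).single_le (hev.mono fun _ => And.left),
      (h.limit b le_rfl hlim).degree_eq (hev.mono fun _ => And.right)⟩

lemma single_le (hD₀ : NonnegAway q D₀) (h : IsGreedyReduction q D₀ β D) :
    Finsupp.single (.vertex q) (D₀ (.vertex q)) ≤ D β :=
  (h.single_le_and_degree_eq hD₀).1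

lemma degree_eq (hD₀ : NonnegAway q D₀) (h : IsGreedyReduction q D₀ β D) :
    degree (D β) = degree D₀ :=
  (h.single_le_and_degree_eq hD₀).2

lemma nonnegAway (hD₀ : NonnegAway q D₀) (h : IsGreedyReduction q D₀ β D) :
    NonnegAway q (D β) :=
  nonnegAway_of_single_le (h.single_le hD₀)

lemma antitoneOn_pairing (h : IsGreedyReduction q D₀ β D) {φ : Γ.Point → ℝ} (hφ : Continuous φ)
    (hf : ∀ f : Γ.Firing q, 0 ≤ pairing f.div φ) :
    AntitoneOn (fun α => pairing (D α) φ) (Set.Iic β) := by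
  refine antitoneOn_of_succ_le_of_tendsto (fun α hα => ?_) fun l hl hlim => h.limit l hl hlim φ hφ
  obtain ⟨f, -, hf'⟩ := h.succ α hα
  rw [hf', pairing_sub]
  linarith [hf f]

lemma exists_tendsto_pairing_of_nonneg (hD₀ : NonnegAway q D₀) {l : Ordinal.{w}}
    (h : ∀ α < l, IsGreedyReduction q D₀ α D) {φ : Γ.Point → ℝ} (hφ : Continuous φ)
    (hf : ∀ f : Γ.Firing q, 0 ≤ pairing f.div φ) :
    ∃ y, Tendsto (fun α => pairing (D α) φ) (𝓝[<] l) (𝓝 y) := by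
  obtain ⟨M, hM⟩ := exists_abs_le_of_continuous hφ
  have hmono : MonotoneOn (fun α => - pairing (D α) φ) (Set.Iio l) := fun a _ b hb hab =>
    neg_le_neg ((h b hb).antitoneOn_pairing hφ hf hab (Set.mem_Iic.2 le_rfl) hab)
  have hbdd : BddAbove ((fun α => - pairing (D α) φ) '' Set.Iio l) := by
    refine ⟨(degree D₀ - D₀ (.vertex q)) * M + |D₀ (.vertex q) * φ (.vertex q)|, ?_⟩
    rintro _ ⟨α, hα, rfl⟩
    rw [← (h α hα).degree_eq hD₀]
    exact (neg_le_abs _).trans (abs_pairing_le ((h α hα).single_le hD₀) hM)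
  exact ⟨_, by simpa only [neg_neg] using (hmono.tendsto_nhdsLT hbdd).neg⟩

theorem exists_limit (hD₀ : NonnegAway q D₀) {l : Ordinal.{w}} (hl : Order.IsSuccLimit l)
    (h : ∀ α < l, IsGreedyReduction q D₀ α D) : ∃ D', DivisorTendsto D (𝓝[<] l) D' := by
  have := nhdsLT_neBot_of_isSuccLimit hl
  refine exists_divisorTendsto (q := q) (c := D₀ (.vertex q)) (d := degree D₀) ?_ fun L φ hφ => ?_
  · filter_upwards [self_mem_nhdsWithin] with α hα
    exact (h α hα).single_le_and_degree_eq hD₀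
  obtain ⟨a, ha⟩ := exists_outflow_eq_one Γ q
  obtain ⟨L', hL'⟩ := exists_edgeLipschitz_linearExtension a
  -- A firing changes the pairing with `φ` by at most `K * len`, so `K` times the potential plus or
  -- minus `φ` never increases. Half the difference of the two limits is the limit for `φ`.
  let K : ℝ := Fintype.card Γ.E * |L|
  have hK : 0 ≤ K := by positivity
  have hpair : ∀ (E : Γ.Divisor) (s : ℝ),
      pairing E (fun p => K * linearExtension a p + s * φ p) =
        K * pairing E (linearExtension a) + s * pairing E φ := fun E s => by
    simp only [pairing, Finsupp.sum, Finset.mul_sum, ← Finset.sum_add_distrib]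
    exact Finset.sum_congr rfl fun p _ => by ring
  have hconv : ∀ s : ℝ, |s| = 1 → ∃ y, Tendsto
      (fun α => K * pairing (D α) (linearExtension a) + s * pairing (D α) φ) (𝓝[<] l) (𝓝 y) := by
    intro s hs
    simp only [← hpair]
    refine exists_tendsto_pairing_of_nonneg hD₀ h
      ((hL'.continuous.const_mul K).add (hφ.continuous.const_mul s)) fun f => ?_
    rw [hpair]
    have h1 := mul_le_mul_of_nonneg_left (f.len_le_pairing_div ha) hK
    have h2 : |s * pairing f.div φ| ≤ K * f.len := by
      rw [abs_mul, hs, one_mul]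
      exact f.abs_pairing_div_le hφ
    linarith [(abs_le.1 h2).1]
  obtain ⟨y₁, h₁⟩ := hconv 1 (by simp)
  obtain ⟨y₂, h₂⟩ := hconv (-1) (by simp)
  refine ⟨(y₁ - y₂) / 2, ((h₁.sub h₂).div_const 2).congr fun α => ?_⟩
  ring

lemma lt_vertexChips_succ (hD₀ : NonnegAway q D₀) {α : Ordinal.{w}} (hα : α < β)
    (h : IsGreedyReduction q D₀ β D) :
    D₀ (.vertex q) + 1 ≤ vertexChips (D (Order.succ α)) := by
  obtain ⟨f, hf, hf'⟩ := h.succ α hα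
  have h1 := (h.mono hα.le).single_le hD₀
  rw [hf']
  exact hf.lt_vertexChips (nonnegAway_of_single_le h1) h1

lemma _root_.MetricGraph.vertexIndicator_le_vertexBump (r : ℝ) :
    (vertexIndicator : Γ.Point → ℝ) ≤ vertexBump 1 r := by
  rintro (x | ⟨e, t, ht⟩)
  · exact le_rfl
  · exact vertexBump_nonneg zero_le_one r _

/-- The bump and the vertex indicator agree at `q`, so a debt there cancels; elsewhere the bump is
at least the indicator. -/
lemma _root_.MetricGraph.vertexChips_add_le_pairing_vertexBump {D : Γ.Divisor} {c : ℤ} {e : Γ.E}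
    {t : ℝ} {ht : 0 < t ∧ t < Γ.length e} (hD : Finsupp.single (.vertex q) c ≤ D)
    (hp : 1 ≤ D (.interior e t ht)) (r : ℝ) :
    vertexChips D + vertexBump 1 r (.interior e t ht) ≤ pairing D (vertexBump 1 r) := by
  have h0 : 0 ≤ D - Finsupp.single (.interior e t ht) 1 - Finsupp.single (.vertex q) c := by
    classical
    intro x
    have hx := hD x
    simp only [Finsupp.single_apply, Finsupp.sub_apply, Finsupp.coe_zero, Pi.zero_apply] at hx ⊢
    by_cases h1 : Point.interior e t ht = x
    · subst h1
      simpa using hp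
    · simpa [h1] using hx
  have := pairing_mono_right h0 (vertexIndicator_le_vertexBump r)
  have hi : vertexIndicator (Point.interior e t ht) = 0 := rfl
  have hv : vertexIndicator (Point.vertex q) = 1 := rfl
  have hv' : vertexBump 1 r (Point.vertex q) = 1 := rfl
  rw [pairing_sub, pairing_sub, pairing_single, pairing_single, pairing_sub, pairing_sub,
    pairing_single, pairing_single, pairing_vertexIndicator, hi, hv, hv'] at this
  push_cast at this
  linarith

/-- If there are `m` chips at vertices cofinally before a limit stage, there is at least one more
at the limit stage. -/
theorem lt_vertexChips_limit (hD₀ : NonnegAway q D₀) {l : Ordinal.{w}} (hl : Order.IsSuccLimit l)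
    (h : IsGreedyReduction q D₀ l D) {m : ℤ}
    (hm : ∀ α < l, ∃ α', α < α' ∧ α' < l ∧ m ≤ vertexChips (D α')) :
    m + 1 ≤ vertexChips (D l) := by
  by_contra! hlt
  have := nhdsLT_neBot_of_isSuccLimit hl
  obtain ⟨r, hr, hlen, hS⟩ := exists_radius (D l).support
  obtain ⟨a, ha⟩ := exists_outflow_eq_one Γ q
  obtain ⟨L', hL'⟩ := exists_edgeLipschitz_linearExtension a
  -- The radius `r` keeps the bump away from the interior chips of `D l`.
  have hχ : pairing (D l) (vertexBump 1 r) = vertexChips (D l) := by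
    rw [← pairing_vertexIndicator]
    refine Finset.sum_congr rfl fun p hp => ?_
    refine congrArg _ ?_
    rcases p with x | ⟨e, t, ht⟩
    · rfl
    · exact vertexBump_interior_eq_zero hr (hS e t ht hp).1 (hS e t ht hp).2
  have h1 := h.limit l le_rfl hl _
    (edgeLipschitz_vertexBump (a := 1) (M := 1) hr (by simp) hlen).continuous
  have h2 := h.limit l le_rfl hl _ hL'.continuous
  rw [hχ] at h1
  have hev := (h1.eventually_lt_const (u := (vertexChips (D l) : ℝ) + 1 / 2) (by linarith)).and
    (h2.eventually_lt_const (u := pairing (D l) (linearExtension a) + r / 2) (by linarith))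
  obtain ⟨α₀, hα₀, hα₀'⟩ := (mem_nhdsLT_iff_exists_Ioo_subset' hl.bot_lt).1 hev
  obtain ⟨α, hlt', hαl, hmα⟩ := hm α₀ hα₀
  obtain ⟨hα1, hα2⟩ := hα₀' ⟨hlt', hαl⟩
  obtain ⟨f, hf, hf'⟩ := h.succ α hαl
  have hle := (h.mono hαl.le).single_le hD₀
  have hnn := nonnegAway_of_single_le hle
  -- If the chip reaching a vertex starts at a vertex, it crosses a whole edge. Otherwise it adds at
  -- least `1 - len / r` to the bump pairing on top of the vertex chips, and this must be below `1 /
  -- 2`.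
  have hflen : r / 2 ≤ f.len := by
    obtain ⟨e, he, hreach⟩ := hf.exists_reaches hnn
    rcases (f.start_nonneg e he).eq_or_lt with h0 | h0
    · linarith [hlen e]
    have hchip := hf.1.one_le_start hnn he
    obtain ⟨ht, hpt⟩ := ptFrom_interior (A := f.side) h0 (f.start_lt he)
    rw [hpt] at hchip
    have hle' := vertexChips_add_le_pairing_vertexBump hle hchip r
    have hbump : 1 - f.len / r ≤ vertexBump 1 r (.interior e _ ht) := by
      simp only [vertexBump, ofEdges, Pi.one_apply, one_mul]
      split_ifs
      · rw [← hreach, add_sub_cancel_left]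
        exact (le_max_right _ _).trans (le_add_of_nonneg_left (le_max_left _ _))
      · rw [← hreach, add_sub_cancel_left]
        exact (le_max_right _ _).trans (le_add_of_nonneg_right (le_max_left _ _))
    have hint : (vertexChips (D l) : ℝ) ≤ vertexChips (D α) := by
      exact_mod_cast (by omega : vertexChips (D l) ≤ vertexChips (D α))
    have hhalf : 1 / 2 ≤ f.len / r := by
      linarith
    rw [le_div_iff₀ hr] at hhalf
    linarith
  -- This firing would lower the potential by at least `r / 2`, hence below its value at `l`, which
  -- monotonicity forbids.
  have hanti := h.antitoneOn_pairing hL'.continuous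
    (fun f => f.len_pos.le.trans (f.len_le_pairing_div ha))
    (hl.succ_lt hαl).le (Set.mem_Iic.2 le_rfl) (hl.succ_lt hαl).le
  simp only [hf', pairing_sub] at hanti
  linarith [f.len_le_pairing_div ha]

/-! ### Blocks of length `ω ^ n` and the time bound. -/

lemma _root_.Ordinal.isSuccLimit_add_omega0_opow_succ (γ : Ordinal.{w}) (n : ℕ) :
    Order.IsSuccLimit (γ + ω ^ ((n + 1 : ℕ) : Ordinal.{w})) :=
  Ordinal.isSuccLimit_add γ
    (Ordinal.isSuccLimit_opow_left Ordinal.isSuccLimit_omega0 (by exact_mod_cast n.succ_ne_zero))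

/-- A block of length `ω ^ (n + 1)` consists of `ω` blocks of length `ω ^ n`, whose ends are cofinal
in it. -/
lemma _root_.Ordinal.exists_add_omega0_opow_between {γ α : Ordinal.{w}} {n : ℕ}
    (hα : α < γ + ω ^ ((n + 1 : ℕ) : Ordinal.{w})) :
    ∃ δ, α < δ + ω ^ (n : Ordinal.{w}) ∧
      δ + ω ^ (n : Ordinal.{w}) < γ + ω ^ ((n + 1 : ℕ) : Ordinal.{w}) := by
  have hpos : (0 : Ordinal.{w}) < ω ^ (n : Ordinal.{w}) := Ordinal.opow_pos _ Ordinal.omega0_pos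
  rw [Nat.cast_succ, Ordinal.opow_add, Ordinal.opow_one] at hα ⊢
  obtain ⟨k, hk⟩ : ∃ k : ℕ, α < γ + ω ^ (n : Ordinal.{w}) * (k + 1 : ℕ) := by
    by_cases h : α < γ
    · exact ⟨0, h.trans_le le_self_add⟩
    · obtain ⟨b, rfl⟩ := exists_add_of_le (not_lt.1 h)
      rw [add_lt_add_iff_left, Ordinal.lt_mul_iff_of_isSuccLimit Ordinal.isSuccLimit_omega0] at hα
      obtain ⟨c, hc, hb⟩ := hα
      obtain ⟨k, rfl⟩ := Ordinal.lt_omega0.1 hc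
      refine ⟨k, by
        rw [add_lt_add_iff_left]
        exact hb.trans_le (mul_le_mul_right (by exact_mod_cast k.le_succ) _)⟩
  refine ⟨γ + ω ^ (n : Ordinal.{w}) * k, ?_, ?_⟩
  · rwa [Nat.cast_succ, mul_add, mul_one, ← add_assoc] at hk
  · rw [add_assoc, add_lt_add_iff_left]
    nth_rewrite 2 [← mul_one (ω ^ (n : Ordinal.{w}))]
    rw [← mul_add, mul_lt_mul_iff_right₀ hpos]
    exact_mod_cast Ordinal.natCast_lt_omega0 (k + 1)

/-- The offset `γ` lets the induction hypothesis apply to every subblock, so that `n + 1` chips are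
at vertices cofinally before the limit. -/
theorem lt_vertexChips_add_opow (hD₀ : NonnegAway q D₀) (n : ℕ) (γ : Ordinal.{w})
    (h : IsGreedyReduction q D₀ (γ + ω ^ (n : Ordinal.{w})) D) :
    (n : ℤ) + 1 ≤ vertexChips (D (γ + ω ^ (n : Ordinal.{w}))) - D₀ (.vertex q) := by
  induction n generalizing γ with
  | zero =>
    have hγ : γ + ω ^ ((0 : ℕ) : Ordinal.{w}) = Order.succ γ := by
      rw [Nat.cast_zero, Ordinal.opow_zero, Order.succ_eq_add_one]
    rw [hγ] at h ⊢
    have := h.lt_vertexChips_succ hD₀ (Order.lt_succ γ)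
    push_cast
    linarith
  | succ n ih =>
    have := h.lt_vertexChips_limit hD₀ (Ordinal.isSuccLimit_add_omega0_opow_succ γ n)
      (m := n + 1 + D₀ (.vertex q)) fun α hα => by
        obtain ⟨δ, h1, h2⟩ := Ordinal.exists_add_omega0_opow_between hα
        exact ⟨_, h1, h2, by linarith [ih δ (h.mono h2.le)]⟩
    push_cast at this ⊢
    linarith

theorem lt_opow (hD₀ : NonnegAway q D₀) (h : IsGreedyReduction q D₀ β D) :
    β < ω ^ (((degree D₀ - D₀ (.vertex q)).toNat : ℕ) : Ordinal.{w}) := by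
  by_contra! hβ
  have h' := h.mono hβ
  have h1 := lt_vertexChips_add_opow hD₀ (degree D₀ - D₀ (.vertex q)).toNat 0
    (by rwa [zero_add])
  rw [zero_add] at h1
  have h2 := vertexChips_le_degree (sub_nonneg.2 (h'.single_le hD₀))
  rw [vertexChips_sub, vertexChips_single, degree_sub, degree_single, h'.degree_eq hD₀] at h2
  omega

end IsGreedyReduction

/-! ### Continuation of a greedy reduction -/

open Classical in
/-- One maximal legal firing, if there is a legal firing. -/
noncomputable def greedyStep (q : Γ.V) (D : Γ.Divisor) : Γ.Divisor :=
  if h : ∃ f : Γ.Firing q, f.MaximalLegal D then D - h.choose.div else D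

open Classical in
/-- A limit of a transfinite sequence of divisors, if it exists. -/
noncomputable def divisorLimit (l : Ordinal.{w}) (D : Ordinal.{w} → Γ.Divisor) : Γ.Divisor :=
  if h : ∃ D', DivisorTendsto D (𝓝[<] l) D' then h.choose else 0

open Classical in
/-- The continuation of a greedy reduction after the stage `β`. -/
noncomputable def continuation (q : Γ.V) (β : Ordinal.{w}) (D : Ordinal.{w} → Γ.Divisor) :
    Ordinal.{w} → Γ.Divisor :=
  WellFounded.fix (C := fun _ => Γ.Divisor) Ordinal.lt_wf fun α rec =>
    if α ≤ β then D α
    else if h : ∃ α', α = Order.succ α' then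
      greedyStep q (rec h.choose (by
        conv_rhs => rw [h.choose_spec]
        exact Order.lt_succ _))
    else divisorLimit α fun a => if h : a < α then rec a h else 0

section continuation

variable {q : Γ.V} {D₀ : Γ.Divisor} {β : Ordinal.{w}} {D : Ordinal.{w} → Γ.Divisor}

lemma continuation_of_le {α : Ordinal.{w}} (h : α ≤ β) : continuation q β D α = D α := by
  rw [continuation, WellFounded.fix_eq, if_pos h]

lemma continuation_succ {α : Ordinal.{w}} (h : β ≤ α) :
    continuation q β D (Order.succ α) = greedyStep q (continuation q β D α) := by
  have h' : ∃ α', Order.succ α = Order.succ α' := ⟨α, rfl⟩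
  have hc : h'.choose = α := (Order.succ_injective h'.choose_spec).symm
  rw [continuation, WellFounded.fix_eq, if_neg (Order.lt_succ_iff.2 h).not_ge, dif_pos h']
  exact congrArg (fun a => greedyStep q (continuation q β D a)) hc

lemma continuation_limit {l : Ordinal.{w}} (hl : Order.IsSuccLimit l) (h : β < l)
    (hex : ∃ D', DivisorTendsto (continuation q β D) (𝓝[<] l) D') :
    DivisorTendsto (continuation q β D) (𝓝[<] l) (continuation q β D l) := by
  classical
  -- The recursion sees only stages before `l`; the filler value `0` from `l` onwards is invisible
  -- to the limit from the left.
  let E : Ordinal.{w} → Γ.Divisor := fun a => if a < l then continuation q β D a else 0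
  have heq : E =ᶠ[𝓝[<] l] continuation q β D := by
    filter_upwards [self_mem_nhdsWithin] with a ha
    exact if_pos ha
  have hval : continuation q β D l = divisorLimit l E := by
    rw [continuation, WellFounded.fix_eq, if_neg h.not_ge, dif_neg]
    · rfl
    · rintro ⟨a, rfl⟩
      exact Order.not_isSuccLimit_succ a hl
  have hex' : ∃ D', DivisorTendsto E (𝓝[<] l) D' := by
    obtain ⟨D', hD'⟩ := hex
    exact ⟨D', fun φ hφ => (hD' φ hφ).congr' (heq.symm.mono fun a ha => by rw [ha])⟩
  intro φ hφ
  rw [hval, divisorLimit, dif_pos hex']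
  exact (hex'.choose_spec φ hφ).congr' (heq.mono fun a ha => by rw [ha])

lemma isGreedyReduction_continuation (hD₀ : NonnegAway q D₀) (h : IsGreedyReduction q D₀ β D)
    (γ : Ordinal.{w})
    (hγ : ∀ α, β ≤ α → α < γ → ∃ f : Γ.Firing q, f.Legal (continuation q β D α)) :
    IsGreedyReduction q D₀ γ (continuation q β D) := by
  induction γ using WellFoundedLT.induction with
  | ind γ ih =>
  have ih' : ∀ α < γ, IsGreedyReduction q D₀ α (continuation q β D) := fun α hα =>
    ih α hα fun α' h1 h2 => hγ α' h1 (h2.trans hα)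
  refine ⟨?_, fun α hα => ?_, fun l hl hlim => ?_⟩
  · rw [continuation_of_le zero_le, h.zero]
  · rcases lt_or_ge α β with hαβ | hβα
    · rw [continuation_of_le hαβ.le, continuation_of_le (Order.succ_le_of_lt hαβ)]
      exact h.succ α hαβ
    · obtain ⟨f, hf⟩ := hγ α hβα hα
      have hex := hf.exists_maximalLegal ((ih' α hα).nonnegAway hD₀)
      rw [continuation_succ hβα, greedyStep, dif_pos hex]
      exact ⟨_, hex.choose_spec, rfl⟩
  · rcases le_or_gt l β with hlβ | hβl
    · intro φ hφ
      rw [continuation_of_le hlβ]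
      refine (h.limit l hlβ hlim φ hφ).congr' ?_
      filter_upwards [self_mem_nhdsWithin] with a ha
      rw [continuation_of_le ((le_of_lt ha).trans hlβ)]
    · exact continuation_limit hlim hβl
        (IsGreedyReduction.exists_limit hD₀ hlim fun α hα => ih' α (hα.trans_le hl))

theorem IsGreedyReduction.exists_terminating (hD₀ : NonnegAway q D₀)
    (h : IsGreedyReduction q D₀ β D) :
    ∃ (γ : Ordinal.{w}) (D' : Ordinal.{w} → Γ.Divisor), β ≤ γ ∧ (∀ α ≤ β, D' α = D α) ∧
      IsGreedyReduction q D₀ γ D' ∧ ∀ f : Γ.Firing q, ¬ f.Legal (D' γ) := by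
  have hex : ∃ γ, β ≤ γ ∧ ∀ f : Γ.Firing q, ¬ f.Legal (continuation q β D γ) := by
    by_contra! hcon
    -- The implicit stage is `ω ^ d` itself, which the strict bound excludes.
    exact lt_irrefl _ ((isGreedyReduction_continuation hD₀ h _
      fun α hα _ => hcon α hα).lt_opow hD₀)
  obtain ⟨γ, ⟨hβγ, hγ⟩, hmin⟩ := Ordinal.lt_wf.has_min {γ | β ≤ γ ∧ ∀ f : Γ.Firing q,
    ¬ f.Legal (continuation q β D γ)} hex
  refine ⟨γ, continuation q β D, hβγ, fun α hα => continuation_of_le hα,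
    isGreedyReduction_continuation hD₀ h γ fun α hα hαγ => ?_, hγ⟩
  by_contra! hcon
  exact hmin α ⟨hα, hcon⟩ hαγ

end continuation

end MetricGraph

/-! ### The theorem. -/

open MetricGraph in
theorem theorem4 (Γ : MetricGraph.{u, v}) (q : Γ.V) (D₀ : Γ.Divisor) (hD₀ : NonnegAway q D₀) :
    -- any greedy reduction takes time at most `ω ^ d`, `d` the number of chips away from `q`
    (∀ (β : Ordinal.{w}) (D : Ordinal.{w} → Γ.Divisor), IsGreedyReduction q D₀ β D →
      β ≤ ω ^ (((degree D₀ - D₀ (Point.vertex q)).toNat : ℕ) : Ordinal.{w})) ∧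
    -- in particular at most `ω ^ deg(D₀)` if there is no debt at `q`
    (0 ≤ D₀ (Point.vertex q) →
      ∀ (β : Ordinal.{w}) (D : Ordinal.{w} → Γ.Divisor), IsGreedyReduction q D₀ β D →
        β ≤ ω ^ (((degree D₀).toNat : ℕ) : Ordinal.{w})) ∧
    -- at stage `ω ^ n`, at least `n + 1` chips, not counting those initially at `q`, are at vertices
    (∀ (β : Ordinal.{w}) (D : Ordinal.{w} → Γ.Divisor), IsGreedyReduction q D₀ β D →
      ∀ n : ℕ, ω ^ (n : Ordinal.{w}) ≤ β →
        (n : ℤ) + 1 ≤ vertexChips (D (ω ^ (n : Ordinal.{w}))) - D₀ (Point.vertex q)) ∧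
    -- one can always pass to the limit
    (∀ (l : Ordinal.{w}) (D : Ordinal.{w} → Γ.Divisor), Order.IsSuccLimit l →
      (∀ α < l, IsGreedyReduction q D₀ α D) → ∃ D' : Γ.Divisor, DivisorTendsto D (𝓝[<] l) D') ∧
    -- any greedy reduction continues to one that ends at a divisor without legal firings
    (∀ (β : Ordinal.{w}) (D : Ordinal.{w} → Γ.Divisor), IsGreedyReduction q D₀ β D →
      ∃ (γ : Ordinal.{w}) (D' : Ordinal.{w} → Γ.Divisor), β ≤ γ ∧ (∀ α ≤ β, D' α = D α) ∧
        IsGreedyReduction q D₀ γ D' ∧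
        (∀ f : Γ.Firing q, ¬ f.Legal (D' γ))) := by
  refine ⟨fun β D h => (h.lt_opow hD₀).le, fun hq β D h => (h.lt_opow hD₀).le.trans ?_,
    fun β D h n hn => ?_, fun l D hl h => IsGreedyReduction.exists_limit hD₀ hl h,
    fun β D h => h.exists_terminating hD₀⟩
  · exact Ordinal.opow_le_opow_right Ordinal.omega0_pos
      (by exact_mod_cast Int.toNat_le_toNat (by omega))
  · have := IsGreedyReduction.lt_vertexChips_add_opow hD₀ n 0 (by rw [zero_add]; exact h.mono hn)
    rwa [zero_add] at this
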